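/- Call a set $\mathcal C\subset\mathbb R^2$ an algebraic curve of constant width $\alpha>0$ if $\mathcal C=\gamma([-\pi,\pi])$ with $$\gamma(\theta)=\bigl(p(\theta)\cos\theta-p'(\theta)\sin\theta,\; p(\theta)\sin\theta+p'(\theta)\cos\theta\bigr),$$ where $p$ is a trigonometric polynomial of the form $$p(\theta)=\frac{\alpha}{2}+\sum_{k=0}^{N}\bigl(a_{2k+1}\cos(2k+1)\theta+b_{2k+1}\sin(2k+1)\theta\bigr),\qquad N\ge 0,\ a_{2k+1},b_{2k+1}\in\mathbb R,$$ such that $p+p''\ge 0$ on $\mathbb R$ (that is, $p$ is the support function of the convex region bounded by $\mathcal C$). Call it non-circular if it is not a circle. A defining polynomial of $\mathcal C$ is an irreducible $f\in\mathbb R[x,y]$ that generates the ideal of all polynomials in $\mathbb R[x,y]$ vanishing on $\mathcal C$; degree means total degree. Then the minimal degree of a defining polynomial of a non-circular algebraic curve of constant width (over all $\alpha>0$) is $8$. Moreover, every nonzero polynomial in $\mathbb R[x,y]$ that vanishes on a non-circular algebraic curve of constant width has degree at least $8$. The value $8$ is attained, for example, for $\alpha=1$ and $p(\theta)=\tfrac12+\tfrac1{16}\cos3\theta$: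 the corresponding curve is a non-circular algebraic curve of constant width $1$ and has a defining polynomial of degree $8$. -/

import Mathlib

open Real

/-- The parametrization
`γ(θ) = (p(θ) cos θ - p'(θ) sin θ, p(θ) sin θ + p'(θ) cos θ)`. If `p` is the smooth support function
of a compact convex set, it traces the boundary of that set. -/
noncomputable def supportParam (p : ℝ → ℝ) (θ : ℝ) : EuclideanSpace ℝ (Fin 2) :=
  !₂[p θ * cos θ - deriv p θ * sin θ, p θ * sin θ + deriv p θ * cos θ]

/-- The set of points traced by `supportParam p` on `[-π, π]`. -/
noncomputable def supportCurve (p : ℝ → ℝ) : Set (EuclideanSpace ℝ (Fin 2)) :=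
  supportParam p '' Set.Icc (-π) π

/-- `p` is a trigonometric polynomial with constant term `α / 2`, `α > 0`, and all other harmonics
odd, which satisfies the convexity condition `p + p'' ≥ 0`. -/
def IsConstantWidthSupport (α : ℝ) (p : ℝ → ℝ) : Prop :=
  0 < α ∧
  (∃ (N : ℕ) (a b : ℕ → ℝ), ∀ θ : ℝ,
    p θ = α / 2 + ∑ k ∈ Finset.range (N + 1),
      (a k * cos ((2 * (k : ℝ) + 1) * θ) + b k * sin ((2 * (k : ℝ) + 1) * θ))) ∧
  ∀ θ : ℝ, 0 ≤ p θ + deriv (deriv p) θ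

/-- `C` is an algebraic curve of constant width `α`: it is the curve with support function a
trigonometric polynomial as above. -/
def IsAlgebraicCurveOfConstantWidth (α : ℝ) (C : Set (EuclideanSpace ℝ (Fin 2))) : Prop :=
  ∃ p : ℝ → ℝ, IsConstantWidthSupport α p ∧ C = supportCurve p

/-- `C` is a Euclidean circle. -/
def IsCircle (C : Set (EuclideanSpace ℝ (Fin 2))) : Prop :=
  ∃ (c : EuclideanSpace ℝ (Fin 2)) (r : ℝ), C = Metric.sphere c r

/-- The polynomial `g ∈ ℝ[x, y]` is zero at every point of `C`. -/
def VanishesOn (g : MvPolynomial (Fin 2) ℝ) (C : Set (EuclideanSpace ℝ (Fin 2))) : Prop :=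
  ∀ P ∈ C, MvPolynomial.eval (fun i => P i) g = 0

/-- `f` is a defining polynomial of `C`: it is irreducible in `ℝ[x, y]` and generates the ideal of
all polynomials that vanish on `C` (so `f = 0` is the equation of the Zariski closure of `C`, and
`f` is unique up to a nonzero constant factor). -/
def IsDefiningPolynomial (f : MvPolynomial (Fin 2) ℝ)
    (C : Set (EuclideanSpace ℝ (Fin 2))) : Prop :=
  Irreducible f ∧ ∀ g : MvPolynomial (Fin 2) ℝ, VanishesOn g C ↔ f ∣ g

/-- The support function `p(θ) = 1/2 + (1/16) cos 3θ`. -/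
noncomputable def exampleSupport (θ : ℝ) : ℝ := 1 / 2 + 1 / 16 * cos (3 * θ)

/-! Put `z = exp (i θ)`. Along the curve, `x + i y = (p + i p') z` and `x - i y` become Laurent
polynomials `W`, `V` in `z`. A real polynomial vanishing on the curve vanishes for every `z ≠ 0`,
because its pullback has infinitely many zeros.

Lower bound. Let `2N + 1 ≥ 3` be the top harmonic. Then `x` is a Laurent polynomial with extreme
exponents `±(2N + 2)`, so a generic line `x = c` meets the complexified curve at `4N + 4`
parameters. These give distinct ordinates. If two parameters gave one point, the gradient of `G`
there, whose `y`-component is nonzero for generic `c`, would fix the normal direction and hence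
`z²`. The remaining ambiguity `z ↔ -z` is excluded by constant width: `W z - W (-z) = α z`. So `G(c,
·)` has `4N + 4` roots, and `deg G ≥ 4N + 4 ≥ 8` (`natDegree_le_natDegree_of_evalEval_eq_zero`,
`le_natDegree_of_laurent_vanish`). With no harmonic above the first, the curve is a circle.

Attainment. An explicit octic vanishes on the example and is monic of degree `8 = 4·1 + 4` in `y`.
By the lower bound this degree is minimal, so division with remainder and comparison of degrees show
that it is irreducible and generates the ideal (`isDefiningPolynomial_of_monic`). -/

section BivariateCurve

/-! ### Degree bound for polynomials vanishing on a Laurent-parametrized curve -/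

open Polynomial

/-- Chain rule for a bivariate polynomial along a curve; the coefficient of the first velocity
component depends only on the base point. -/
theorem exists_hasDerivAt_evalEval (G : Polynomial (Polynomial ℂ)) (x y : ℂ) :
    ∃ B : ℂ, ∀ (u v : ℂ → ℂ) (u' v' z : ℂ), HasDerivAt u u' z → HasDerivAt v v' z →
      u z = x → v z = y →
        HasDerivAt (fun w => evalEval (u w) (v w) G)
          (B * u' + evalEval x y (derivative G) * v') z := by
  induction G using Polynomial.induction_on' with
  | add p q hp hq =>
    obtain ⟨B₁, h₁⟩ := hp
    obtain ⟨B₂, h₂⟩ := hq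
    refine ⟨B₁ + B₂, fun u v u' v' z hu hv hx hy => ?_⟩
    have h := (h₁ u v u' v' z hu hv hx hy).add (h₂ u v u' v' z hu hv hx hy)
    have e : (fun w => evalEval (u w) (v w) (p + q)) =
        (fun w => evalEval (u w) (v w) p) + fun w => evalEval (u w) (v w) q := by
      funext w
      simp [evalEval_add]
    rw [e]
    refine h.congr_deriv ?_
    simp only [evalEval_add, derivative_add]
    ring
  | monomial n a =>
    -- The witness is the partial derivative in the first variable. Being independent of the curve,
    -- it is shared by all branches through `(x, y)`.
    refine ⟨(derivative a).eval x * y ^ n, fun u v u' v' z hu hv hx hy => ?_⟩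
    have ha : HasDerivAt (fun w => a.eval (u w)) ((derivative a).eval x * u') z := by
      have h := HasDerivAt.comp z (a.hasDerivAt (u z)) hu
      rw [hx] at h
      exact h
    have h := ha.mul (hv.pow n)
    have e : (fun w => evalEval (u w) (v w) (monomial n a)) =
        (fun w => a.eval (u w)) * (v ^ n) := by
      funext w
      simp [evalEval, eval_monomial]
    rw [e]
    refine h.congr_deriv ?_
    subst hx hy
    simp only [evalEval, derivative_monomial, eval_monomial, Pi.pow_apply, eval_mul, eval_natCast,
      eval_pow, eval_C]
    ring

/-- Clearing denominators in a bivariate polynomial evaluated at fractions with powers of `z` as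
denominators. -/
theorem exists_evalEval_mul_pow_eq (p q : ℂ[X]) (M : ℕ) (u v : ℂ → ℂ)
    (hu : ∀ z ≠ 0, u z * z ^ M = p.eval z) (hv : ∀ z ≠ 0, v z * z ^ M = q.eval z)
    (G : Polynomial (Polynomial ℂ)) :
    ∃ (K : ℕ) (Q : ℂ[X]), ∀ z ≠ 0, evalEval (u z) (v z) G * z ^ K = Q.eval z := by
  have hadd : ∀ f g : ℂ → ℂ, (∃ (K : ℕ) (Q : ℂ[X]), ∀ z ≠ 0, f z * z ^ K = Q.eval z) →
      (∃ (K : ℕ) (Q : ℂ[X]), ∀ z ≠ 0, g z * z ^ K = Q.eval z) →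
      ∃ (K : ℕ) (Q : ℂ[X]), ∀ z ≠ 0, (f z + g z) * z ^ K = Q.eval z := by
    rintro f g ⟨K, Q, h⟩ ⟨K', Q', h'⟩
    refine ⟨K + K', Q * X ^ K' + Q' * X ^ K, fun z hz => ?_⟩
    simp only [eval_add, eval_mul, eval_pow, eval_X, ← h z hz, ← h' z hz]
    ring
  have hpow : ∀ (f : ℂ → ℂ) (r : ℂ[X]), (∀ z ≠ 0, f z * z ^ M = r.eval z) →
      ∀ n : ℕ, ∀ z ≠ 0, f z ^ n * z ^ (M * n) = (r ^ n).eval z := by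
    intro f r h n z hz
    rw [eval_pow, ← h z hz, mul_pow, pow_mul]
  have hone : ∀ a : ℂ[X], ∃ (K : ℕ) (Q : ℂ[X]), ∀ z ≠ 0, a.eval (u z) * z ^ K = Q.eval z := by
    intro a
    induction a using Polynomial.induction_on' with
    | add a b ha hb => simpa only [eval_add] using hadd _ _ ha hb
    | monomial n c =>
      refine ⟨M * n, C c * p ^ n, fun z hz => ?_⟩
      rw [eval_mul, eval_C, ← hpow u p hu n z hz, eval_monomial]
      ring
  induction G using Polynomial.induction_on' with
  | add a b ha hb => simpa only [evalEval_add] using hadd _ _ ha hb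
  | monomial n a =>
    obtain ⟨K, Q, h⟩ := hone a
    refine ⟨K + M * n, Q * q ^ n, fun z hz => ?_⟩
    rw [eval_mul, ← h z hz, ← hpow v q hv n z hz]
    simp only [evalEval, eval_monomial, eval_mul, eval_pow, eval_C]
    ring

theorem eq_zero_of_eval_eq_zero_of_ne_zero (Q : ℂ[X]) (h : ∀ z ≠ 0, Q.eval z = 0) : Q = 0 := by
  refine Q.eq_zero_of_infinite_isRoot (Set.Infinite.mono (s := {0}ᶜ) (fun z hz => h z hz) ?_)
  exact (Set.finite_singleton (0 : ℂ)).infinite_compl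

/-- If `u z = p z / z ^ M`, then a level set of `u` off a finite set of levels consists of
`p.natDegree` simple points. -/
theorem exists_finset_level (p : ℂ[X]) (M : ℕ) (hM : M ≠ 0) (hp : M < p.natDegree)
    (hp0 : p.eval 0 ≠ 0) (c : ℂ)
    (hc : ∀ z ≠ 0, (X * derivative p - C (M : ℂ) * p).eval z = 0 → p.eval z ≠ c * z ^ M) :
    ∃ S : Finset ℂ, S.card = p.natDegree ∧ ∀ z ∈ S, z ≠ 0 ∧ p.eval z = c * z ^ M := by
  set P := p - C c * X ^ M with hP
  have hlt : (C c * X ^ M).natDegree < p.natDegree := (natDegree_C_mul_X_pow_le c M).trans_lt hp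
  have hdeg : P.natDegree = p.natDegree := natDegree_sub_eq_left_of_natDegree_lt hlt
  have hP0 : P ≠ 0 := by
    rintro h
    rw [h, natDegree_zero] at hdeg
    omega
  have hroot : ∀ z, P.IsRoot z → z ≠ 0 ∧ p.eval z = c * z ^ M := by
    intro z hz
    have hz' : p.eval z = c * z ^ M := by
      simpa [hP, IsRoot.def, sub_eq_zero] using hz
    refine ⟨?_, hz'⟩
    rintro rfl
    exact hp0 (by simpa [hM] using hz')
  -- A double root of `p - c z ^ M` satisfies `z p' = M p`, which `hc` forbids.
  have hnodup : P.roots.Nodup := by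
    rw [Multiset.nodup_iff_count_le_one]
    intro z
    rw [count_roots]
    by_contra! h
    obtain ⟨h1, h2⟩ := (one_lt_rootMultiplicity_iff_isRoot hP0).1 h
    obtain ⟨hz, hz'⟩ := hroot z h1
    refine hc z hz ?_ hz'
    have h3 : (derivative p).eval z = c * (M * z ^ (M - 1)) := by
      have : (derivative P).eval z = 0 := h2
      simpa [hP, derivative_X_pow, sub_eq_zero] using this
    obtain ⟨m, rfl⟩ := Nat.exists_eq_succ_of_ne_zero hM
    simp only [eval_sub, eval_mul, eval_X, eval_C, h3, hz', Nat.succ_eq_add_one,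
      Nat.add_sub_cancel, pow_succ]
    ring
  refine ⟨P.roots.toFinset, ?_, fun z hz => hroot z ?_⟩
  · rw [Multiset.toFinset_card_of_nodup hnodup, IsAlgClosed.card_roots_eq_natDegree, hdeg]
  · exact isRoot_of_mem_roots (Multiset.mem_toFinset.1 hz)

/-- Let `z ↦ (u z, v z)` be a Laurent parametrization with velocity proportional to
`(-(z² - 1), i (z² + 1))`, and suppose `z` is determined by `(z², u z, v z)`. Then a nonzero
bivariate polynomial that vanishes along it has degree at least the degree of the numerator of `u`
in the second variable. -/
theorem natDegree_le_natDegree_of_evalEval_eq_zero (p q : ℂ[X]) (M : ℕ) (hM : M ≠ 0)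
    (hp : M < p.natDegree) (hp0 : p.eval 0 ≠ 0) (u v u' v' : ℂ → ℂ)
    (hu : ∀ z ≠ 0, u z * z ^ M = p.eval z) (hv : ∀ z ≠ 0, v z * z ^ M = q.eval z)
    (hu' : ∀ z ≠ 0, HasDerivAt u (u' z) z) (hv' : ∀ z ≠ 0, HasDerivAt v (v' z) z)
    (hrel : ∀ z ≠ 0, Complex.I * u' z * (z ^ 2 + 1) + v' z * (z ^ 2 - 1) = 0)
    (hinj : ∀ z ≠ 0, ∀ w ≠ 0, z ^ 2 = w ^ 2 → u z = u w → v z = v w → z = w)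
    (G : Polynomial (Polynomial ℂ)) (hG : G ≠ 0)
    (hvan : ∀ z ≠ 0, evalEval (u z) (v z) G = 0) :
    p.natDegree ≤ G.natDegree := by
  classical
  induction hn : G.natDegree using Nat.strong_induction_on generalizing G with
  | _ n ih =>
  subst hn
  have hsurj : ∀ c, ∃ z ≠ 0, u z = c := by
    intro c
    set P := p - C c * X ^ M with hP
    have hlt : (C c * X ^ M).natDegree < p.natDegree := (natDegree_C_mul_X_pow_le c M).trans_lt hp
    have hdeg : P.natDegree = p.natDegree := natDegree_sub_eq_left_of_natDegree_lt hlt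
    obtain ⟨z, hz⟩ := IsAlgClosed.exists_root P (by
      intro h
      have : P.natDegree = 0 := natDegree_eq_of_degree_eq_some h
      omega)
    have hz' : p.eval z = c * z ^ M := by simpa [hP, IsRoot.def, sub_eq_zero] using hz
    have hz0 : z ≠ 0 := by
      rintro rfl
      exact hp0 (by simpa [hM] using hz')
    refine ⟨z, hz0, ?_⟩
    rw [← hu z hz0] at hz'
    exact mul_right_cancel₀ (pow_ne_zero _ hz0) hz'
  -- If `G` did not involve `y`, it would be a polynomial in `x` vanishing at every value of `u`,
  -- that is, on all of `ℂ`.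
  have hpos : G.natDegree ≠ 0 := by
    intro h0
    obtain ⟨g, rfl⟩ := natDegree_eq_zero.1 h0
    refine hG ?_
    rw [Polynomial.funext (p := g) (q := 0), C_0]
    intro c
    obtain ⟨z, hz, rfl⟩ := hsurj c
    simpa [evalEval_C] using hvan z hz
  have hdG : derivative G ≠ 0 := fun h => hpos (derivative_eq_zero.1 h)
  obtain ⟨K, Q, hQ⟩ := exists_evalEval_mul_pow_eq p q M u v hu hv (derivative G)
  -- If `∂G/∂y` also vanishes along the curve, it has smaller degree and the induction hypothesis
  -- applies. Otherwise it has finitely many zeros there.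
  by_cases hQ0 : Q = 0
  · have hlt : (derivative G).natDegree < G.natDegree := natDegree_derivative_lt hpos
    refine (ih _ hlt (derivative G) hdG (fun z hz => ?_) rfl).trans hlt.le
    have := hQ z hz
    rw [hQ0, eval_zero] at this
    exact (mul_eq_zero.1 this).resolve_right (pow_ne_zero _ hz)
  -- `R = z ^ (M + 1) u'`, so the roots of `R` off the origin are the critical points of `u`.
  set R := X * derivative p - C (M : ℂ) * p with hR
  have hR0 : R ≠ 0 := by
    intro h
    have : R.eval 0 = 0 := by rw [h, eval_zero]
    simp [hR, hM, hp0] at this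
  -- The level `c` avoids the zeros of `∂G/∂y` on the curve, the critical values of `u`, and the
  -- zeros of the leading coefficient of `G`.
  obtain ⟨c, hc⟩ := Infinite.exists_notMem_finset
    ((Q.roots.toFinset ∪ R.roots.toFinset).image u ∪ G.leadingCoeff.roots.toFinset)
  simp only [Finset.mem_union, Finset.mem_image, Multiset.mem_toFinset, not_or, not_exists,
    not_and] at hc
  obtain ⟨hc1, hc2⟩ := hc
  have hcQ : ∀ z ≠ 0, u z = c → Q.eval z ≠ 0 := fun z _ h h0 =>
    hc1 z (Or.inl ((mem_roots hQ0).2 h0)) h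
  have hcR : ∀ z ≠ 0, u z = c → R.eval z ≠ 0 := fun z _ h h0 =>
    hc1 z (Or.inr ((mem_roots hR0).2 h0)) h
  have hlc : G.leadingCoeff.eval c ≠ 0 := fun h =>
    hc2 ((mem_roots (leadingCoeff_ne_zero.2 hG)).2 h)
  have huc : ∀ z ≠ 0, p.eval z = c * z ^ M → u z = c := by
    intro z hz h
    rw [← hu z hz] at h
    exact mul_right_cancel₀ (pow_ne_zero _ hz) h
  obtain ⟨S, hS, hSz⟩ := exists_finset_level p M hM hp hp0 c
    (fun z hz h h' => hcR z hz (huc z hz h') h)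
  have hu'ne : ∀ z ≠ 0, u z = c → u' z ≠ 0 := by
    intro z hz h h0
    refine hcR z hz h ?_
    have h1 : HasDerivAt (fun w => u w * w ^ M) (u' z * z ^ M + u z * (M * z ^ (M - 1))) z :=
      (hu' z hz).mul (hasDerivAt_pow M z)
    have h2 : HasDerivAt (fun w => u w * w ^ M) ((derivative p).eval z) z := by
      refine (p.hasDerivAt z).congr_of_eventuallyEq ?_
      filter_upwards [isOpen_ne.mem_nhds hz] with w hw using hu w hw
    have h3 := h1.unique h2
    rw [h0] at h3
    simp only [hR, eval_sub, eval_mul, eval_X, eval_C, ← h3, ← hu z hz]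
    obtain ⟨m, rfl⟩ := Nat.exists_eq_succ_of_ne_zero hM
    simp only [Nat.succ_eq_add_one, Nat.add_sub_cancel, pow_succ]
    ring
  have hvinj : Set.InjOn v S := by
    intro z hz w hw hzw
    obtain ⟨hz0, hz1⟩ := hSz z hz
    obtain ⟨hw0, hw1⟩ := hSz w hw
    have hz2 := huc z hz0 hz1
    have hw2 := huc w hw0 hw1
    refine hinj z hz0 w hw0 ?_ (hz2.trans hw2.symm) hzw
    obtain ⟨B, hB⟩ := exists_hasDerivAt_evalEval G (u z) (v z)
    set A := evalEval (u z) (v z) (derivative G) with hA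
    have hA0 : A ≠ 0 := by
      intro h
      refine hcQ z hz0 hz2 ?_
      rw [← hQ z hz0, ← hA, h, zero_mul]
    -- Tangency `B u' + A v' = 0` with the known velocity direction is a linear equation for `t²`
    -- whose coefficients depend only on the point. It is nondegenerate because `A ≠ 0`.
    have key : ∀ t ≠ 0, u t = u z → v t = v z →
        t ^ 2 * (A + Complex.I * B) = -(A - Complex.I * B) ∧ A + Complex.I * B ≠ 0 := by
      intro t ht htu htv
      have h1 := hB u v (u' t) (v' t) t (hu' t ht) (hv' t ht) htu htv
      have h2 : HasDerivAt (fun w => evalEval (u w) (v w) G) 0 t := by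
        refine (hasDerivAt_const t (0 : ℂ)).congr_of_eventuallyEq ?_
        filter_upwards [isOpen_ne.mem_nhds ht] with w hw using hvan w hw
      have h3 := h1.unique h2
      have h4 := hrel t ht
      have h5 := hu'ne t ht (htu.trans hz2)
      have h6 : t ^ 2 * (A + Complex.I * B) = -(A - Complex.I * B) := by
        have : u' t * (t ^ 2 * (A + Complex.I * B) - -(A - Complex.I * B)) = 0 := by
          linear_combination (-Complex.I * A) * h4 + (Complex.I * (t ^ 2 - 1)) * h3 +
            (A * u' t * (t ^ 2 + 1)) * Complex.I_sq
        exact sub_eq_zero.1 ((mul_eq_zero.1 this).resolve_left h5)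
      refine ⟨h6, fun h => hA0 ?_⟩
      rw [h, mul_zero] at h6
      linear_combination h / 2 + h6 / 2
    have hz3 := key z hz0 rfl rfl
    have hw3 := key w hw0 (hw2.trans hz2.symm) hzw.symm
    exact mul_right_cancel₀ hz3.2 (hz3.1.trans hw3.1.symm)
  set H : ℂ[X] := G.map (evalRingHom c) with hH
  have hH0 : H ≠ 0 := by
    intro h
    have : H.coeff G.natDegree = 0 := by rw [h, coeff_zero]
    rw [hH, coeff_map] at this
    exact hlc this
  calc p.natDegree = (S.image v).card := by rw [Finset.card_image_of_injOn hvinj, hS]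
    _ ≤ H.roots.toFinset.card := by
      refine Finset.card_le_card fun y hy => ?_
      obtain ⟨z, hz, rfl⟩ := Finset.mem_image.1 hy
      obtain ⟨hz0, hz1⟩ := hSz z hz
      rw [Multiset.mem_toFinset, mem_roots hH0, IsRoot.def, hH, map_evalRingHom_eval,
        ← huc z hz0 hz1]
      exact hvan z hz0
    _ ≤ H.natDegree := (Multiset.toFinset_card_le _).trans (card_roots' _)
    _ ≤ G.natDegree := natDegree_map_le

end BivariateCurve

/-! ### The complexified curve of constant width -/

section LaurentCurve

open Polynomial

/-- The Laurent polynomial that `x + i y` becomes along a curve of constant width, as a function of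
`z = exp (i θ)`. -/
noncomputable def laurentW (a : ℂ) (N : ℕ) (β β' : ℕ → ℂ) (z : ℂ) : ℂ :=
  a * z + ∑ k ∈ Finset.range (N + 1),
    (-(2 * k) * β k * z ^ (2 * k + 2) + (2 * k + 2) * β' k * z⁻¹ ^ (2 * k))

/-- The Laurent polynomial that `x - i y` becomes along a curve of constant width, as a function of
`z = exp (i θ)`. -/
noncomputable def laurentV (a : ℂ) (N : ℕ) (β β' : ℕ → ℂ) (z : ℂ) : ℂ :=
  a * z⁻¹ + ∑ k ∈ Finset.range (N + 1),
    ((2 * k + 2) * β k * z ^ (2 * k) + -(2 * k) * β' k * z⁻¹ ^ (2 * k + 2))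

/-- The abscissa of the complexified curve. -/
noncomputable def laurentX (a : ℂ) (N : ℕ) (β β' : ℕ → ℂ) (z : ℂ) : ℂ :=
  (laurentW a N β β' z + laurentV a N β β' z) / 2

/-- The ordinate of the complexified curve. -/
noncomputable def laurentY (a : ℂ) (N : ℕ) (β β' : ℕ → ℂ) (z : ℂ) : ℂ :=
  (laurentW a N β β' z - laurentV a N β β' z) / (2 * Complex.I)

/-- The derivative of `laurentW`. -/
noncomputable def laurentWDeriv (a : ℂ) (N : ℕ) (β β' : ℕ → ℂ) (z : ℂ) : ℂ :=
  a + ∑ k ∈ Finset.range (N + 1),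
    (-(2 * k) * β k * ((2 * k + 2) * z ^ (2 * k + 1)) +
      (2 * k + 2) * β' k * (-(2 * k) * z⁻¹ ^ (2 * k + 1)))

variable (a : ℂ) (N : ℕ) (β β' : ℕ → ℂ)

theorem inv_pow_mul_pow_add (j m : ℕ) {z : ℂ} (hz : z ≠ 0) :
    z⁻¹ ^ j * z ^ (j + m) = z ^ m := by
  rw [pow_add, ← mul_assoc, ← mul_pow, inv_mul_cancel₀ hz, one_pow, one_mul]

theorem hasDerivAt_inv_pow (n : ℕ) {z : ℂ} (hz : z ≠ 0) :
    HasDerivAt (fun z : ℂ => z⁻¹ ^ n) (-n * z⁻¹ ^ (n + 1)) z := by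
  refine ((hasDerivAt_inv hz).pow n).congr_deriv ?_
  cases n with
  | zero => simp
  | succ n =>
    rw [Nat.add_sub_cancel, ← inv_pow]
    ring

theorem hasDerivAt_pow_of_ne_zero (n : ℕ) {z : ℂ} (hz : z ≠ 0) :
    HasDerivAt (fun z : ℂ => z ^ n) (n * z ^ (n + 1) * (z⁻¹) ^ 2) z := by
  refine (hasDerivAt_pow n z).congr_deriv ?_
  cases n with
  | zero => simp
  | succ n =>
    rw [Nat.add_sub_cancel]
    field_simp
    ring

theorem hasDerivAt_laurentW {z : ℂ} (hz : z ≠ 0) :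
    HasDerivAt (laurentW a N β β') (laurentWDeriv a N β β' z) z := by
  unfold laurentW laurentWDeriv
  refine HasDerivAt.add (((hasDerivAt_id z).const_mul a).congr_deriv (mul_one a))
    (HasDerivAt.fun_sum fun k _ => HasDerivAt.add ?_ ?_)
  · refine ((hasDerivAt_pow (2 * k + 2) z).const_mul _).congr_deriv ?_
    push_cast
    simp
  · refine ((hasDerivAt_inv_pow (2 * k) hz).const_mul _).congr_deriv ?_
    push_cast
    ring

/-- `V' = -W' / z²` expresses that the tangent at parameter `θ` is orthogonal to `(cos θ, sin θ)`;
it yields the velocity relation. -/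
theorem hasDerivAt_laurentV {z : ℂ} (hz : z ≠ 0) :
    HasDerivAt (laurentV a N β β') (-(laurentWDeriv a N β β' z) * z⁻¹ ^ 2) z := by
  have hd : -(laurentWDeriv a N β β' z) * z⁻¹ ^ 2 =
      a * (-z⁻¹ ^ 2) + ∑ k ∈ Finset.range (N + 1),
        ((2 * k + 2) * β k * ((2 * k : ℕ) * z ^ (2 * k + 1) * z⁻¹ ^ 2) +
          -(2 * k) * β' k * (-(2 * k + 2 : ℕ) * z⁻¹ ^ (2 * k + 2 + 1))) := by
    simp only [laurentWDeriv, neg_add, add_mul, ← Finset.sum_neg_distrib, Finset.sum_mul]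
    congr 1
    · ring
    · refine Finset.sum_congr rfl fun k _ => ?_
      push_cast
      ring
  rw [hd]
  unfold laurentV
  refine HasDerivAt.add (((hasDerivAt_inv hz).const_mul a).congr_deriv (by rw [inv_pow]))
    (HasDerivAt.fun_sum fun k _ => HasDerivAt.add ?_ ?_)
  · exact (hasDerivAt_pow_of_ne_zero (2 * k) hz).const_mul _
  · exact (hasDerivAt_inv_pow (2 * k + 2) hz).const_mul _

/-- The numerator of `laurentW` over the denominator `z ^ (2 * N + 2)`. -/
noncomputable def numW : ℂ[X] :=
  C a * X ^ (2 * N + 3) + ∑ k ∈ Finset.range (N + 1),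
    (C (-(2 * k) * β k) * X ^ (2 * N + 2 * k + 4) +
      C ((2 * k + 2) * β' k) * X ^ (2 * N + 2 - 2 * k))

/-- The numerator of `laurentV` over the denominator `z ^ (2 * N + 2)`. -/
noncomputable def numV : ℂ[X] :=
  C a * X ^ (2 * N + 1) + ∑ k ∈ Finset.range (N + 1),
    (C ((2 * k + 2) * β k) * X ^ (2 * N + 2 * k + 2) +
      C (-(2 * k) * β' k) * X ^ (2 * N - 2 * k))

theorem laurentW_mul_pow {z : ℂ} (hz : z ≠ 0) :
    laurentW a N β β' z * z ^ (2 * N + 2) = (numW a N β β').eval z := by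
  simp only [laurentW, numW, add_mul, Finset.sum_mul, eval_add, eval_mul, eval_C, eval_pow, eval_X,
    eval_finsetSum]
  congr 1
  · ring
  · refine Finset.sum_congr rfl fun k hk => ?_
    congr 1
    · ring
    -- Since `k ≤ N`, writing `N = k + m` removes the truncated subtraction in the exponent.
    · obtain ⟨m, rfl⟩ := Nat.exists_eq_add_of_le (Finset.mem_range_succ_iff.1 hk)
      rw [show 2 * (k + m) + 2 - 2 * k = 2 * m + 2 by omega,
        show 2 * (k + m) + 2 = 2 * k + (2 * m + 2) by ring]
      linear_combination (2 * (k : ℂ) + 2) * β' k * inv_pow_mul_pow_add (2 * k) (2 * m + 2) hz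

theorem laurentV_mul_pow {z : ℂ} (hz : z ≠ 0) :
    laurentV a N β β' z * z ^ (2 * N + 2) = (numV a N β β').eval z := by
  simp only [laurentV, numV, add_mul, Finset.sum_mul, eval_add, eval_mul, eval_C, eval_pow, eval_X,
    eval_finsetSum]
  congr 1
  · rw [mul_assoc, ← pow_one z⁻¹, show 2 * N + 2 = 1 + (2 * N + 1) by ring,
      inv_pow_mul_pow_add _ _ hz]
  · refine Finset.sum_congr rfl fun k hk => ?_
    congr 1
    · ring
    · obtain ⟨m, rfl⟩ := Nat.exists_eq_add_of_le (Finset.mem_range_succ_iff.1 hk)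
      rw [show 2 * (k + m) - 2 * k = 2 * m by omega, mul_assoc,
        show 2 * (k + m) + 2 = 2 * k + 2 + 2 * m by ring, inv_pow_mul_pow_add _ _ hz]

theorem coeff_numW_top : (numW a N β β').coeff (4 * N + 4) = -(2 * N) * β N := by
  rw [numW, coeff_add, finsetSum_coeff, Finset.sum_eq_single N]
  · simp only [coeff_add, coeff_C_mul, coeff_X_pow]
    rw [if_neg (by omega), if_pos (by omega), if_neg (by omega)]
    ring
  · intro k hk hkN
    have := Finset.mem_range.1 hk
    simp only [coeff_add, coeff_C_mul, coeff_X_pow]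
    rw [if_neg (by omega), if_neg (by omega)]
    ring
  · simp

theorem coeff_numV_top : (numV a N β β').coeff (4 * N + 4) = 0 := by
  rw [numV, coeff_add, finsetSum_coeff, Finset.sum_eq_zero]
  · simp only [coeff_C_mul, coeff_X_pow]
    rw [if_neg (by omega)]
    ring
  · intro k hk
    have := Finset.mem_range.1 hk
    simp only [coeff_add, coeff_C_mul, coeff_X_pow]
    rw [if_neg (by omega), if_neg (by omega)]
    ring

theorem coeff_numW_zero : (numW a N β β').coeff 0 = 0 := by
  rw [numW, coeff_add, finsetSum_coeff, Finset.sum_eq_zero]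
  · simp only [coeff_C_mul, coeff_X_pow]
    rw [if_neg (by omega)]
    ring
  · intro k hk
    have := Finset.mem_range.1 hk
    simp only [coeff_add, coeff_C_mul, coeff_X_pow]
    rw [if_neg (by omega), if_neg (by omega)]
    ring

theorem coeff_numV_zero : (numV a N β β').coeff 0 = -(2 * N) * β' N := by
  rw [numV, coeff_add, finsetSum_coeff, Finset.sum_eq_single N]
  · simp only [coeff_add, coeff_C_mul, coeff_X_pow]
    rw [if_neg (by omega), if_neg (by omega), if_pos (by omega)]
    ring
  · intro k hk hkN
    have := Finset.mem_range.1 hk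
    simp only [coeff_add, coeff_C_mul, coeff_X_pow]
    rw [if_neg (by omega), if_neg (by omega)]
    ring
  · simp

theorem natDegree_numW_le : (numW a N β β').natDegree ≤ 4 * N + 4 := by
  refine natDegree_add_le_of_degree_le ((natDegree_C_mul_X_pow_le _ _).trans (by omega))
    (natDegree_sum_le_of_forall_le _ _ fun k hk => natDegree_add_le_of_degree_le
      ((natDegree_C_mul_X_pow_le _ _).trans ?_) ((natDegree_C_mul_X_pow_le _ _).trans ?_)) <;>
  · have := Finset.mem_range.1 hk
    omega

theorem natDegree_numV_le : (numV a N β β').natDegree ≤ 4 * N + 4 := by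
  refine natDegree_add_le_of_degree_le ((natDegree_C_mul_X_pow_le _ _).trans (by omega))
    (natDegree_sum_le_of_forall_le _ _ fun k hk => natDegree_add_le_of_degree_le
      ((natDegree_C_mul_X_pow_le _ _).trans ?_) ((natDegree_C_mul_X_pow_le _ _).trans ?_)) <;>
  · have := Finset.mem_range.1 hk
    omega

/-- In `W` all exponents but that of `a z` are even, because the harmonics are odd. This is constant
width: opposite parameters give points differing by `2 a z`. -/
theorem laurentW_sub_laurentW_neg (z : ℂ) :
    laurentW a N β β' z - laurentW a N β β' (-z) = 2 * a * z := by
  have h : ∀ k : ℕ, (-z) ^ (2 * k + 2) = z ^ (2 * k + 2) ∧ (-z)⁻¹ ^ (2 * k) = z⁻¹ ^ (2 * k) := by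
    intro k
    refine ⟨Even.neg_pow ⟨k + 1, by ring⟩ z, ?_⟩
    rw [inv_neg]
    exact Even.neg_pow ⟨k, by ring⟩ _
  simp only [laurentW, (h _).1, (h _).2]
  ring

theorem laurentX_add_I_mul_laurentY (z : ℂ) :
    laurentX a N β β' z + Complex.I * laurentY a N β β' z = laurentW a N β β' z := by
  unfold laurentX laurentY
  field_simp
  ring

/-- A nonzero polynomial that vanishes on the complexified curve has degree at least `4 * N + 4` in
the second variable. -/
theorem le_natDegree_of_laurent_vanish (ha : a ≠ 0) (hN : N ≠ 0) (hβ : β N ≠ 0) (hβ' : β' N ≠ 0)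
    (G : Polynomial (Polynomial ℂ)) (hG : G ≠ 0)
    (hvan : ∀ z ≠ 0, evalEval (laurentX a N β β' z) (laurentY a N β β' z) G = 0) :
    4 * N + 4 ≤ G.natDegree := by
  have hN' : (N : ℂ) ≠ 0 := Nat.cast_ne_zero.2 hN
  set p : ℂ[X] := C (1 / 2) * (numW a N β β' + numV a N β β') with hp
  have hpdeg : p.natDegree = 4 * N + 4 := by
    refine natDegree_eq_of_le_of_coeff_ne_zero ?_ ?_
    · exact (natDegree_C_mul_le _ _).trans (natDegree_add_le_of_degree_le
        (natDegree_numW_le a N β β') (natDegree_numV_le a N β β'))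
    · rw [hp, coeff_C_mul, coeff_add, coeff_numW_top, coeff_numV_top]
      simp [hN', hβ]
  have hp0 : p.eval 0 ≠ 0 := by
    rw [← coeff_zero_eq_eval_zero, hp, coeff_C_mul, coeff_add, coeff_numW_zero, coeff_numV_zero]
    simp [hN', hβ']
  rw [← hpdeg]
  refine natDegree_le_natDegree_of_evalEval_eq_zero p
    (C (1 / (2 * Complex.I)) * (numW a N β β' - numV a N β β')) (2 * N + 2) (by omega)
    (by omega) hp0 (laurentX a N β β') (laurentY a N β β')
    (fun z => (laurentWDeriv a N β β' z + -(laurentWDeriv a N β β' z) * z⁻¹ ^ 2) / 2)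
    (fun z => (laurentWDeriv a N β β' z - -(laurentWDeriv a N β β' z) * z⁻¹ ^ 2) /
      (2 * Complex.I)) ?_ ?_ ?_ ?_ ?_ ?_ G hG hvan
  · intro z hz
    rw [hp, eval_mul, eval_add, eval_C, ← laurentW_mul_pow a N β β' hz,
      ← laurentV_mul_pow a N β β' hz, laurentX]
    ring
  · intro z hz
    rw [eval_mul, eval_sub, eval_C, ← laurentW_mul_pow a N β β' hz,
      ← laurentV_mul_pow a N β β' hz, laurentY]
    ring
  · intro z hz
    exact ((hasDerivAt_laurentW a N β β' hz).add (hasDerivAt_laurentV a N β β' hz)).div_const 2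
  · intro z hz
    exact ((hasDerivAt_laurentW a N β β' hz).sub (hasDerivAt_laurentV a N β β' hz)).div_const _
  · intro z hz
    field_simp
    rw [Complex.I_sq]
    ring
  · intro z hz w hw hzw hx hy
    have hW : laurentW a N β β' z = laurentW a N β β' w := by
      rw [← laurentX_add_I_mul_laurentY, ← laurentX_add_I_mul_laurentY, hx, hy]
    rcases sq_eq_sq_iff_eq_or_eq_neg.1 hzw with h | h
    · exact h
    · have h1 := laurentW_sub_laurentW_neg a N β β' z
      rw [hW, h, neg_neg, sub_self] at h1
      simp [ha, hw] at h1

end LaurentCurve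

/-! ### From the real curve to its complexification, and defining polynomials -/

section SupportCurve

open Polynomial
open Polynomial.Bivariate (equivMvPolynomial)

/-- The trigonometric polynomial with constant term `α / 2` and odd harmonics `a k`, `b k`. -/
noncomputable def oddTrigSupport (α : ℝ) (N : ℕ) (a b : ℕ → ℝ) (θ : ℝ) : ℝ :=
  α / 2 + ∑ k ∈ Finset.range (N + 1),
    (a k * cos ((2 * (k : ℝ) + 1) * θ) + b k * sin ((2 * (k : ℝ) + 1) * θ))

variable (α : ℝ) (N : ℕ) (a b : ℕ → ℝ)

theorem hasDerivAt_oddTrigSupport (θ : ℝ) :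
    HasDerivAt (oddTrigSupport α N a b) (∑ k ∈ Finset.range (N + 1),
      (2 * (k : ℝ) + 1) * (-(a k * sin ((2 * (k : ℝ) + 1) * θ)) +
        b k * cos ((2 * (k : ℝ) + 1) * θ))) θ := by
  unfold oddTrigSupport
  refine HasDerivAt.const_add _ (HasDerivAt.fun_sum fun k _ => ?_)
  have h : HasDerivAt (fun θ : ℝ => (2 * (k : ℝ) + 1) * θ) (2 * (k : ℝ) + 1) θ :=
    ((hasDerivAt_id θ).const_mul _).congr_deriv (mul_one _)
  exact ((h.cos.const_mul (a k)).add (h.sin.const_mul (b k))).congr_deriv (by ring)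

/-- The Fourier coefficient of `a k * cos + b k * sin` at the positive frequency. -/
noncomputable def fourierPos (k : ℕ) : ℂ := ((a k : ℂ) - b k * Complex.I) / 2

/-- The Fourier coefficient of `a k * cos + b k * sin` at the negative frequency. -/
noncomputable def fourierNeg (k : ℕ) : ℂ := ((a k : ℂ) + b k * Complex.I) / 2

theorem fourierPos_ne_zero {k : ℕ} (h : a k ≠ 0 ∨ b k ≠ 0) : fourierPos a b k ≠ 0 := by
  intro h0
  have hre := congrArg Complex.re h0
  have him := congrArg Complex.im h0
  simp [fourierPos] at hre him
  tauto

theorem fourierNeg_ne_zero {k : ℕ} (h : a k ≠ 0 ∨ b k ≠ 0) : fourierNeg a b k ≠ 0 := by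
  intro h0
  have hre := congrArg Complex.re h0
  have him := congrArg Complex.im h0
  simp [fourierNeg] at hre him
  tauto

theorem ofReal_cos_odd_mul (k : ℕ) (θ : ℝ) :
    ((cos ((2 * (k : ℝ) + 1) * θ) : ℝ) : ℂ) =
      (Complex.exp (θ * Complex.I) ^ (2 * k + 1) +
        (Complex.exp (θ * Complex.I))⁻¹ ^ (2 * k + 1)) / 2 := by
  rw [Complex.ofReal_cos, Complex.cos, ← Complex.exp_neg, ← Complex.exp_nat_mul,
    ← Complex.exp_nat_mul]
  push_cast
  ring_nf

theorem ofReal_sin_odd_mul (k : ℕ) (θ : ℝ) :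
    ((sin ((2 * (k : ℝ) + 1) * θ) : ℝ) : ℂ) =
      ((Complex.exp (θ * Complex.I))⁻¹ ^ (2 * k + 1) -
        Complex.exp (θ * Complex.I) ^ (2 * k + 1)) * Complex.I / 2 := by
  rw [Complex.ofReal_sin, Complex.sin, ← Complex.exp_neg, ← Complex.exp_nat_mul,
    ← Complex.exp_nat_mul]
  push_cast
  ring_nf

/-- Harmonic by harmonic, `p + i p'` multiplies the frequency `m` coefficient by `1 - m`; this gives
the factors `-2k` and `2k + 2` in `laurentW`. -/
theorem laurentW_exp (θ : ℝ) :
    laurentW (α / 2 : ℝ) N (fourierPos a b) (fourierNeg a b) (Complex.exp (θ * Complex.I)) =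
      (oddTrigSupport α N a b θ + Complex.I * (deriv (oddTrigSupport α N a b) θ : ℝ)) *
        Complex.exp (θ * Complex.I) := by
  rw [(hasDerivAt_oddTrigSupport α N a b θ).deriv]
  simp only [oddTrigSupport, Complex.ofReal_add, Complex.ofReal_sum, laurentW, Finset.mul_sum]
  rw [add_assoc, ← Finset.sum_add_distrib, add_mul, Finset.sum_mul]
  congr 1
  refine Finset.sum_congr rfl fun k _ => ?_
  simp only [Complex.ofReal_mul, Complex.ofReal_neg, Complex.ofReal_add, ofReal_cos_odd_mul,
    ofReal_sin_odd_mul, fourierPos, fourierNeg, Complex.ofReal_natCast, Complex.ofReal_one,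
    Complex.ofReal_ofNat]
  set z := Complex.exp (θ * Complex.I)
  have hz : z⁻¹ * z = 1 := inv_mul_cancel₀ (Complex.exp_ne_zero _)
  have hI := Complex.I_sq
  linear_combination (2 * (k : ℂ) + 1) * a k * (z⁻¹ ^ (2 * k) * z⁻¹ - z ^ (2 * k) * z) * z / 2 * hI -
    (2 * (k : ℂ) + 2) * ((a k + b k * Complex.I) / 2) * z⁻¹ ^ (2 * k) * hz

theorem laurentV_exp (θ : ℝ) :
    laurentV (α / 2 : ℝ) N (fourierPos a b) (fourierNeg a b) (Complex.exp (θ * Complex.I)) =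
      (oddTrigSupport α N a b θ - Complex.I * (deriv (oddTrigSupport α N a b) θ : ℝ)) *
        (Complex.exp (θ * Complex.I))⁻¹ := by
  rw [(hasDerivAt_oddTrigSupport α N a b θ).deriv]
  simp only [oddTrigSupport, Complex.ofReal_add, Complex.ofReal_sum, laurentV, Finset.mul_sum]
  rw [add_sub_assoc, ← Finset.sum_sub_distrib, add_mul, Finset.sum_mul]
  congr 1
  refine Finset.sum_congr rfl fun k _ => ?_
  simp only [Complex.ofReal_mul, Complex.ofReal_neg, Complex.ofReal_add, ofReal_cos_odd_mul,
    ofReal_sin_odd_mul, fourierPos, fourierNeg, Complex.ofReal_natCast, Complex.ofReal_one,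
    Complex.ofReal_ofNat]
  set z := Complex.exp (θ * Complex.I)
  have hz : z⁻¹ * z = 1 := inv_mul_cancel₀ (Complex.exp_ne_zero _)
  have hI := Complex.I_sq
  linear_combination
    -(2 * (k : ℂ) + 1) * a k * (z⁻¹ ^ (2 * k) * z⁻¹ - z ^ (2 * k) * z) * z⁻¹ / 2 * hI -
    (2 * (k : ℂ) + 2) * ((a k - b k * Complex.I) / 2) * z ^ (2 * k) * hz

theorem laurentX_exp (θ : ℝ) :
    laurentX (α / 2 : ℝ) N (fourierPos a b) (fourierNeg a b) (Complex.exp (θ * Complex.I)) =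
      (supportParam (oddTrigSupport α N a b) θ 0 : ℝ) := by
  rw [laurentX, laurentW_exp, laurentV_exp, ← Complex.exp_neg, ← neg_mul, Complex.exp_mul_I,
    Complex.exp_mul_I, Complex.cos_neg, Complex.sin_neg]
  simp only [supportParam, PiLp.toLp_apply, Matrix.cons_val_zero]
  push_cast
  linear_combination ((deriv (oddTrigSupport α N a b) θ : ℝ) : ℂ) * Complex.sin θ * Complex.I_sq

theorem laurentY_exp (θ : ℝ) :
    laurentY (α / 2 : ℝ) N (fourierPos a b) (fourierNeg a b) (Complex.exp (θ * Complex.I)) =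
      (supportParam (oddTrigSupport α N a b) θ 1 : ℝ) := by
  rw [laurentY, laurentW_exp, laurentV_exp, ← Complex.exp_neg, ← neg_mul, Complex.exp_mul_I,
    Complex.exp_mul_I, Complex.cos_neg, Complex.sin_neg]
  simp only [supportParam, PiLp.toLp_apply, Matrix.cons_val_one, Matrix.cons_val_zero]
  push_cast
  field_simp
  ring

/-- A polynomial in two variables as a polynomial in the second variable with complex
coefficients. -/
noncomputable def complexBivariate (g : MvPolynomial (Fin 2) ℝ) : Polynomial (Polynomial ℂ) :=
  ((equivMvPolynomial ℝ).symm g).map (mapRingHom Complex.ofRealHom)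

theorem evalEval_equivMvPolynomial_symm (g : MvPolynomial (Fin 2) ℝ) (v : Fin 2 → ℝ) :
    evalEval (v 0) (v 1) ((equivMvPolynomial ℝ).symm g) = MvPolynomial.eval v g := by
  induction g using MvPolynomial.induction_on with
  | C r => simp [evalEval]
  | add p q hp hq => rw [map_add, evalEval_add, hp, hq, map_add]
  | mul_X p i hp =>
    rw [map_mul, evalEval_mul, hp, map_mul]
    fin_cases i <;> simp [evalEval]

theorem evalEval_complexBivariate (g : MvPolynomial (Fin 2) ℝ) (v : Fin 2 → ℝ) :
    evalEval (v 0 : ℂ) (v 1) (complexBivariate g) = (MvPolynomial.eval v g : ℝ) := by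
  rw [← evalEval_equivMvPolynomial_symm]
  exact map_mapRingHom_evalEval Complex.ofRealHom _ _ _

theorem infinite_setOf_exp_mul_I :
    Set.Infinite ((fun θ : ℝ => Complex.exp (θ * Complex.I)) '' Set.Icc (-π) π) := by
  have h : Set.InjOn (fun θ : ℝ => Complex.exp (θ * Complex.I)) (Set.Icc 0 π) := by
    intro s hs t ht hst
    refine injOn_cos hs ht ?_
    have := congrArg Complex.re hst
    simpa [Complex.exp_ofReal_mul_I_re] using this
  refine (((Set.Icc_infinite pi_pos).image h)).mono (Set.image_mono ?_)
  exact Set.Icc_subset_Icc_left (by linarith [pi_pos])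

theorem exists_evalEval_laurent (A : ℂ) (β β' : ℕ → ℂ) (G : Polynomial (Polynomial ℂ)) :
    ∃ (K : ℕ) (Q : ℂ[X]), ∀ z ≠ 0,
      evalEval (laurentX A N β β' z) (laurentY A N β β' z) G * z ^ K = Q.eval z := by
  refine exists_evalEval_mul_pow_eq (C (1 / 2) * (numW A N β β' + numV A N β β'))
    (C (1 / (2 * Complex.I)) * (numW A N β β' - numV A N β β')) (2 * N + 2) _ _ ?_ ?_ G
  · intro z hz
    rw [eval_mul, eval_add, eval_C, ← laurentW_mul_pow A N β β' hz,
      ← laurentV_mul_pow A N β β' hz, laurentX]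
    ring
  · intro z hz
    rw [eval_mul, eval_sub, eval_C, ← laurentW_mul_pow A N β β' hz,
      ← laurentV_mul_pow A N β β' hz, laurentY]
    ring

/-- A real polynomial vanishes on the curve if and only if it vanishes on its complexification. -/
theorem vanishesOn_supportCurve_iff (g : MvPolynomial (Fin 2) ℝ) :
    VanishesOn g (supportCurve (oddTrigSupport α N a b)) ↔ ∀ z ≠ 0,
      evalEval (laurentX (α / 2 : ℝ) N (fourierPos a b) (fourierNeg a b) z)
        (laurentY (α / 2 : ℝ) N (fourierPos a b) (fourierNeg a b) z) (complexBivariate g) = 0 := by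
  have hexp : ∀ θ : ℝ,
      evalEval (laurentX (α / 2 : ℝ) N (fourierPos a b) (fourierNeg a b)
          (Complex.exp (θ * Complex.I)))
        (laurentY (α / 2 : ℝ) N (fourierPos a b) (fourierNeg a b) (Complex.exp (θ * Complex.I)))
        (complexBivariate g) =
      (MvPolynomial.eval (fun i => supportParam (oddTrigSupport α N a b) θ i) g : ℝ) := by
    intro θ
    rw [laurentX_exp, laurentY_exp]
    exact evalEval_complexBivariate g fun i => supportParam (oddTrigSupport α N a b) θ i
  constructor
  · intro h z hz
    obtain ⟨K, Q, hQ⟩ := exists_evalEval_laurent N (α / 2 : ℝ) (fourierPos a b) (fourierNeg a b)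
      (complexBivariate g)
    have hQ0 : Q = 0 := by
      -- The numerator of the pullback has the infinitely many points `exp (i θ)` as roots.
      refine Q.eq_zero_of_infinite_isRoot (infinite_setOf_exp_mul_I.mono ?_)
      rintro _ ⟨θ, hθ, rfl⟩
      have := h _ ⟨θ, hθ, rfl⟩
      simp only [Set.mem_ofPred_eq, IsRoot.def]
      rw [← hQ _ (Complex.exp_ne_zero _), hexp, this, Complex.ofReal_zero, zero_mul]
    have := hQ z hz
    rw [hQ0, eval_zero] at this
    exact (mul_eq_zero.1 this).resolve_right (pow_ne_zero _ hz)
  · rintro h _ ⟨θ, hθ, rfl⟩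
    have := hexp θ
    rw [h _ (Complex.exp_ne_zero _)] at this
    exact_mod_cast this.symm

/-- The vanishing ideal is prime because pullback lands in Laurent polynomials, a domain: the
product of the two numerators is zero. -/
theorem vanishesOn_of_mul (g h : MvPolynomial (Fin 2) ℝ)
    (hgh : VanishesOn (g * h) (supportCurve (oddTrigSupport α N a b))) :
    VanishesOn g (supportCurve (oddTrigSupport α N a b)) ∨
      VanishesOn h (supportCurve (oddTrigSupport α N a b)) := by
  rw [vanishesOn_supportCurve_iff] at *
  rw [vanishesOn_supportCurve_iff]
  obtain ⟨K, Q, hQ⟩ := exists_evalEval_laurent N (α / 2 : ℝ) (fourierPos a b) (fourierNeg a b)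
    (complexBivariate g)
  obtain ⟨L, R, hR⟩ := exists_evalEval_laurent N (α / 2 : ℝ) (fourierPos a b) (fourierNeg a b)
    (complexBivariate h)
  have hQR : Q * R = 0 := by
    refine eq_zero_of_eval_eq_zero_of_ne_zero _ fun z hz => ?_
    have := hgh z hz
    rw [complexBivariate, map_mul, Polynomial.map_mul, evalEval_mul] at this
    rw [eval_mul, ← hQ z hz, ← hR z hz, mul_mul_mul_comm, complexBivariate, complexBivariate, this,
      zero_mul]
  rcases mul_eq_zero.1 hQR with h0 | h0
  · left
    intro z hz
    have := hQ z hz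
    rw [h0, eval_zero] at this
    exact (mul_eq_zero.1 this).resolve_right (pow_ne_zero _ hz)
  · right
    intro z hz
    have := hR z hz
    rw [h0, eval_zero] at this
    exact (mul_eq_zero.1 this).resolve_right (pow_ne_zero _ hz)

theorem mapRingHom_ofRealHom_injective :
    Function.Injective (mapRingHom Complex.ofRealHom) :=
  map_injective _ Complex.ofRealHom.injective

theorem le_natDegree_of_vanishesOn (hα : α ≠ 0) (hN : N ≠ 0) (hab : a N ≠ 0 ∨ b N ≠ 0)
    (g : MvPolynomial (Fin 2) ℝ) (hg : g ≠ 0)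
    (hvan : VanishesOn g (supportCurve (oddTrigSupport α N a b))) :
    4 * N + 4 ≤ ((equivMvPolynomial ℝ).symm g).natDegree := by
  have hdeg : (complexBivariate g).natDegree = ((equivMvPolynomial ℝ).symm g).natDegree :=
    natDegree_map_eq_of_injective mapRingHom_ofRealHom_injective _
  rw [← hdeg]
  refine le_natDegree_of_laurent_vanish (α / 2 : ℝ) N (fourierPos a b) (fourierNeg a b) ?_ hN
    (fourierPos_ne_zero a b hab) (fourierNeg_ne_zero a b hab) _ ?_
    ((vanishesOn_supportCurve_iff α N a b g).1 hvan)
  · exact_mod_cast div_ne_zero hα two_ne_zero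
  · rw [complexBivariate, Ne, Polynomial.map_eq_zero_iff mapRingHom_ofRealHom_injective]
    exact fun h => hg ((map_eq_zero_iff _ (equivMvPolynomial ℝ).symm.injective).1 h)

theorem natDegree_equivMvPolynomial_symm_le (g : MvPolynomial (Fin 2) ℝ) :
    ((equivMvPolynomial ℝ).symm g).natDegree ≤ g.totalDegree := by
  conv_lhs => rw [g.as_sum, map_sum]
  refine natDegree_sum_le_of_forall_le _ _ fun s hs => ?_
  rw [MvPolynomial.monomial_eq, map_mul, Finsupp.prod_fintype _ _ (by simp), Fin.prod_univ_two,
    map_mul, map_pow, map_pow, Bivariate.equivMvPolynomial_symm_C,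
    Bivariate.equivMvPolynomial_symm_X_0, Bivariate.equivMvPolynomial_symm_X_1, ← C_pow,
    ← mul_assoc, ← C_mul]
  refine (natDegree_C_mul_X_pow_le _ _).trans (le_trans ?_ (MvPolynomial.le_totalDegree hs))
  rw [Finsupp.sum_fintype _ _ (by simp), Fin.sum_univ_two]
  omega

/-- A polynomial vanishing on the curve that is monic of the least possible degree in the second
variable is a defining polynomial. -/
theorem isDefiningPolynomial_of_monic (hα : α ≠ 0) (hN : N ≠ 0) (hab : a N ≠ 0 ∨ b N ≠ 0)
    (f : MvPolynomial (Fin 2) ℝ) (hf : ((equivMvPolynomial ℝ).symm f).Monic)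
    (hdeg : ((equivMvPolynomial ℝ).symm f).natDegree = 4 * N + 4)
    (hvan : VanishesOn f (supportCurve (oddTrigSupport α N a b))) :
    IsDefiningPolynomial f (supportCurve (oddTrigSupport α N a b)) := by
  have hlow := le_natDegree_of_vanishesOn α N a b hα hN hab
  set e := (equivMvPolynomial ℝ).symm with he
  have hf0 : f ≠ 0 := by
    rintro rfl
    rw [map_zero] at hf
    exact hf.ne_zero rfl
  have hunit : ∀ g h : MvPolynomial (Fin 2) ℝ, f = g * h →
      VanishesOn g (supportCurve (oddTrigSupport α N a b)) → IsUnit h := by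
    intro g h hgh hg
    have hg0 : g ≠ 0 := by
      rintro rfl
      exact hf0 (by rw [hgh, zero_mul])
    have hh0 : h ≠ 0 := by
      rintro rfl
      exact hf0 (by rw [hgh, mul_zero])
    have h1 : e f = e g * e h := by rw [hgh, map_mul]
    have h2 : (e g).natDegree + (e h).natDegree = 4 * N + 4 := by
      rw [← natDegree_mul ((map_ne_zero_iff _ e.injective).2 hg0)
        ((map_ne_zero_iff _ e.injective).2 hh0), ← h1, hdeg]
    have h3 := hlow g hg0 hg
    -- The factor `g` already has all of the minimal degree. So `h` is free of `y`, and monicity of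
    -- `f` makes it a unit.
    have h4 : (e h).natDegree = 0 := by omega
    have h5 : (e g).leadingCoeff * (e h).leadingCoeff = 1 := by
      rw [← leadingCoeff_mul, ← h1, hf.leadingCoeff]
    rw [← MulEquiv.isUnit_map e, eq_C_of_natDegree_eq_zero h4, isUnit_C]
    rw [leadingCoeff, leadingCoeff, h4] at h5
    exact IsUnit.of_mul_eq_one_right _ h5
  refine ⟨⟨fun hu => ?_, fun g h hgh => ?_⟩, fun g => ⟨fun hg => ?_, ?_⟩⟩
  · have := natDegree_eq_zero_of_isUnit ((MulEquiv.isUnit_map e).2 hu)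
    omega
  · rcases vanishesOn_of_mul α N a b g h (hgh ▸ hvan) with hv | hv
    · exact Or.inr (hunit g h hgh hv)
    · exact Or.inl (hunit h g (by rw [hgh, mul_comm]) hv)
  -- The remainder vanishes on the curve and has degree below the minimum, so it is zero.
  · set r := e.symm (e g %ₘ e f) with hr
    have hgr : g = r + f * e.symm (e g /ₘ e f) := by
      apply e.injective
      rw [map_add, map_mul, hr, AlgEquiv.apply_symm_apply, AlgEquiv.apply_symm_apply,
        modByMonic_add_div]
    by_cases hr0 : r = 0
    · rw [hr0, zero_add] at hgr
      exact ⟨_, hgr⟩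
    · exfalso
      have hrv : VanishesOn r (supportCurve (oddTrigSupport α N a b)) := by
        intro P hP
        have h1 := hg P hP
        rw [hgr, map_add, map_mul, hvan P hP, zero_mul, add_zero] at h1
        exact h1
      have h1 := hlow r hr0 hrv
      rw [hr, AlgEquiv.apply_symm_apply, ← hdeg] at h1
      have h2 := natDegree_modByMonic_lt (e g) hf (fun h => by
        rw [h, natDegree_one] at hdeg
        omega)
      omega
  · rintro ⟨h, rfl⟩ P hP
    rw [map_mul, hvan P hP, zero_mul]

end SupportCurve

/-! ### Circles, the lower bound 8, and the octic of the example -/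

section ConstantWidth

open Polynomial (C X Monic monic_X_pow_add natDegree)
open Polynomial.Bivariate (equivMvPolynomial)

/-- The highest harmonics can be dropped as long as they vanish. -/
theorem exists_oddTrigSupport_top_ne_zero (α : ℝ) (N : ℕ) (a b : ℕ → ℝ) :
    oddTrigSupport α N a b = oddTrigSupport α 0 a b ∨
      ∃ M ≠ 0, (a M ≠ 0 ∨ b M ≠ 0) ∧ oddTrigSupport α N a b = oddTrigSupport α M a b := by
  induction N with
  | zero => exact Or.inl rfl
  | succ n ih =>
    by_cases h : a (n + 1) ≠ 0 ∨ b (n + 1) ≠ 0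
    · exact Or.inr ⟨n + 1, n.succ_ne_zero, h, rfl⟩
    · rw [not_or, not_not, not_not] at h
      have e : oddTrigSupport α (n + 1) a b = oddTrigSupport α n a b := by
        funext θ
        rw [oddTrigSupport, Finset.sum_range_succ, h.1, h.2, zero_mul, zero_mul, add_zero, add_zero,
          oddTrigSupport]
      rwa [e]

/-- The first harmonic of a support function only translates the curve, by `(a 0, b 0)`. -/
theorem isCircle_supportCurve_zero {α : ℝ} (hα : 0 < α) (a b : ℕ → ℝ) :
    IsCircle (supportCurve (oddTrigSupport α 0 a b)) := by
  have hp : ∀ θ, supportParam (oddTrigSupport α 0 a b) θ =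
      !₂[a 0 + α / 2 * cos θ, b 0 + α / 2 * sin θ] := by
    intro θ
    have hcs := cos_sq_add_sin_sq θ
    rw [supportParam, (hasDerivAt_oddTrigSupport α 0 a b θ).deriv]
    simp only [oddTrigSupport, zero_add, Finset.range_one, Finset.sum_singleton, Nat.cast_zero,
      mul_zero, one_mul]
    congr 2
    · linear_combination a 0 * hcs
    · congr 1
      linear_combination b 0 * hcs
  refine ⟨!₂[a 0, b 0], α / 2, ?_⟩
  ext P
  rw [mem_sphere_iff_norm, EuclideanSpace.norm_eq, Real.sqrt_eq_iff_eq_sq (by positivity) (by positivity),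
    Fin.sum_univ_two]
  simp only [PiLp.sub_apply, Matrix.cons_val_zero, Matrix.cons_val_one,
    Real.norm_eq_abs, sq_abs]
  constructor
  · rintro ⟨θ, -, rfl⟩
    rw [hp]
    simp only [Matrix.cons_val_zero, Matrix.cons_val_one]
    linear_combination (α / 2) ^ 2 * cos_sq_add_sin_sq θ
  · intro h
    -- The parameter of `P` is the argument of `P` minus the centre, which lies in `(-π, π]`.
    set w : ℂ := ⟨P 0 - a 0, P 1 - b 0⟩ with hw
    have hnorm : ‖w‖ = α / 2 := by
      rw [Complex.norm_eq_sqrt_sq_add_sq, hw, h, Real.sqrt_sq (by positivity)]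
    have h0 : ‖w‖ * cos w.arg = P 0 - a 0 := Complex.norm_mul_cos_arg w
    have h1 : ‖w‖ * sin w.arg = P 1 - b 0 := Complex.norm_mul_sin_arg w
    refine ⟨w.arg, ⟨(Complex.neg_pi_lt_arg w).le, Complex.arg_le_pi w⟩, ?_⟩
    rw [hp, ← hnorm, h0, h1]
    ext i
    fin_cases i <;> simp

theorem eight_le_totalDegree {α : ℝ} {S : Set (EuclideanSpace ℝ (Fin 2))}
    (hS : IsAlgebraicCurveOfConstantWidth α S) (hcirc : ¬ IsCircle S)
    (g : MvPolynomial (Fin 2) ℝ) (hg : g ≠ 0) (hvan : VanishesOn g S) : 8 ≤ g.totalDegree := by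
  obtain ⟨p, ⟨hα, ⟨N, a, b, hp⟩, -⟩, rfl⟩ := hS
  obtain rfl : p = oddTrigSupport α N a b := funext hp
  rcases exists_oddTrigSupport_top_ne_zero α N a b with h | ⟨M, hM, hab, h⟩
  · rw [h] at hcirc
    exact absurd (isCircle_supportCurve_zero hα a b) hcirc
  · rw [h] at hvan
    have h1 := le_natDegree_of_vanishesOn α M a b hα.ne' hM hab g hg hvan
    have h2 := natDegree_equivMvPolynomial_symm_le g
    omega

/-- The single nonzero coefficient of `exampleSupport`. -/
noncomputable def exampleCoeff (k : ℕ) : ℝ := if k = 1 then 1 / 16 else 0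

theorem exampleSupport_eq : exampleSupport = oddTrigSupport 1 1 exampleCoeff 0 := by
  funext θ
  simp only [exampleSupport, oddTrigSupport, exampleCoeff, Finset.sum_range_succ,
    Finset.range_zero, Finset.sum_empty, Pi.zero_apply]
  norm_num

theorem deriv_exampleSupport : deriv exampleSupport = fun θ => -(3 / 16) * sin (3 * θ) := by
  funext θ
  have h : HasDerivAt (fun θ : ℝ => 3 * θ) 3 θ :=
    ((hasDerivAt_id θ).const_mul 3).congr_deriv (mul_one _)
  exact (((h.cos.const_mul (1 / 16)).const_add (1 / 2)).congr_deriv (by ring)).deriv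

theorem deriv_deriv_exampleSupport (θ : ℝ) :
    deriv (deriv exampleSupport) θ = -(9 / 16) * cos (3 * θ) := by
  rw [deriv_exampleSupport]
  have h : HasDerivAt (fun θ : ℝ => 3 * θ) 3 θ :=
    ((hasDerivAt_id θ).const_mul 3).congr_deriv (mul_one _)
  exact ((h.sin.const_mul (-(3 / 16))).congr_deriv (by ring)).deriv

/-- Here `p + p'' = (1 - cos 3θ) / 2`, so `1/16` is the largest amplitude that keeps convexity. -/
theorem isConstantWidthSupport_exampleSupport : IsConstantWidthSupport 1 exampleSupport := by
  refine ⟨one_pos, ⟨1, exampleCoeff, 0, fun θ => ?_⟩, fun θ => ?_⟩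
  · rw [exampleSupport_eq, oddTrigSupport]
  · rw [deriv_deriv_exampleSupport, exampleSupport]
    linarith [cos_le_one (3 * θ)]

/-- The defining polynomial of the curve with support function `exampleSupport`. -/
noncomputable def exampleOctic : MvPolynomial (Fin 2) ℝ :=
  (MvPolynomial.C (1 / 2) * (MvPolynomial.X 0 ^ 3 -
      MvPolynomial.C 3 * MvPolynomial.X 0 * MvPolynomial.X 1 ^ 2) +
    (MvPolynomial.X 0 ^ 2 + MvPolynomial.X 1 ^ 2 - MvPolynomial.C (81 / 256)) ^ 2 -
    MvPolynomial.C (27 / 64) *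
      (MvPolynomial.X 0 ^ 2 + MvPolynomial.X 1 ^ 2 - MvPolynomial.C (81 / 256)) -
    MvPolynomial.C (729 / 8192)) ^ 2 +
  MvPolynomial.C 2 *
    (MvPolynomial.X 0 ^ 2 + MvPolynomial.X 1 ^ 2 - MvPolynomial.C (81 / 256)) ^ 3

/-- With `K = cos 3θ`, the symmetry invariants `x² + y²` and `x³ - 3xy²` are polynomials in `K`. In
particular `u = x² + y² - 81/256 = -(1 - K)² / 32`. The squared bracket of the octic is that of `-(1
- K)³ / 128`, which cancels `2u³`. -/
theorem vanishesOn_exampleOctic : VanishesOn exampleOctic (supportCurve exampleSupport) := by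
  rintro _ ⟨θ, -, rfl⟩
  simp only [exampleOctic, supportParam, deriv_exampleSupport, exampleSupport, map_add, map_sub,
    map_mul, map_pow, MvPolynomial.eval_C, MvPolynomial.eval_X, PiLp.toLp_apply,
    Matrix.cons_val_zero, Matrix.cons_val_one]
  have hcs := cos_sq_add_sin_sq θ
  have hKS := cos_sq_add_sin_sq (3 * θ)
  have hK : cos (3 * θ) = cos θ ^ 3 - 3 * cos θ * sin θ ^ 2 := by
    rw [cos_three_mul]
    linear_combination (3 * cos θ) * hcs
  have hS : sin (3 * θ) = 3 * cos θ ^ 2 * sin θ - sin θ ^ 3 := by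
    rw [sin_three_mul]
    linear_combination (-3 * sin θ) * hcs
  generalize cos (3 * θ) = K at *
  generalize sin (3 * θ) = S at *
  generalize cos θ = c at *
  generalize sin θ = s at *
  have hu : ((1 / 2 + 1 / 16 * K) * c - -(3 / 16) * S * s) ^ 2 +
      ((1 / 2 + 1 / 16 * K) * s + -(3 / 16) * S * c) ^ 2 - 81 / 256 = -(1 - K) ^ 2 / 32 := by
    linear_combination ((1 / 2 + 1 / 16 * K) ^ 2 + (3 / 16 * S) ^ 2) * hcs + 9 / 256 * hKS
  have ht : ((1 / 2 + 1 / 16 * K) * c - -(3 / 16) * S * s) ^ 3 -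
      3 * ((1 / 2 + 1 / 16 * K) * c - -(3 / 16) * S * s) *
        ((1 / 2 + 1 / 16 * K) * s + -(3 / 16) * S * c) ^ 2 =
      ((1 / 2 + 1 / 16 * K) ^ 3 - 27 / 256 * (1 / 2 + 1 / 16 * K) * (1 - K ^ 2)) * K +
        9 / 16 * (1 / 2 + 1 / 16 * K) ^ 2 * (1 - K ^ 2) - 27 / 4096 * (1 - K ^ 2) ^ 2 := by
    have h1 : S ^ 2 = 1 - K ^ 2 := by linarith
    rw [← h1]
    linear_combination
      (-(1 / 2 + 1 / 16 * K) ^ 3 + 27 / 256 * (1 / 2 + 1 / 16 * K) * S ^ 2) * hK -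
      (9 / 16 * (1 / 2 + 1 / 16 * K) ^ 2 * S - 27 / 4096 * S ^ 3) * hS
  rw [hu, ht]
  ring

theorem equivMvPolynomial_symm_exampleOctic : (equivMvPolynomial ℝ).symm exampleOctic =
    (X ^ 4 + (C (2 * (X ^ 2 - C (81 / 256)) - C (3 / 2) * X - C (27 / 64)) * X ^ 2 +
      C (C (1 / 2) * X ^ 3 + (X ^ 2 - C (81 / 256)) ^ 2 - C (27 / 64) * (X ^ 2 - C (81 / 256)) -
        C (729 / 8192)))) ^ 2 + 2 * (X ^ 2 + C (X ^ 2 - C (81 / 256))) ^ 3 := by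
  simp only [exampleOctic, map_add, map_sub, map_mul, map_pow, map_ofNat,
    Polynomial.Bivariate.equivMvPolynomial_symm_C,
    Polynomial.Bivariate.equivMvPolynomial_symm_X_0,
    Polynomial.Bivariate.equivMvPolynomial_symm_X_1]
  have h : (C (C (3 / 2)) : Polynomial (Polynomial ℝ)) = 3 * C (C (1 / 2)) := by
    rw [show (3 / 2 : ℝ) = 3 * (1 / 2) by norm_num]
    simp only [map_mul, map_ofNat]
  rw [h]
  ring

theorem monic_exampleOctic : ((equivMvPolynomial ℝ).symm exampleOctic).Monic ∧
    ((equivMvPolynomial ℝ).symm exampleOctic).natDegree = 8 := by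
  rw [equivMvPolynomial_symm_exampleOctic]
  generalize (2 * (X ^ 2 - C (81 / 256)) - C (3 / 2) * X - C (27 / 64) : Polynomial ℝ) = A
  generalize (C (1 / 2) * X ^ 3 + (X ^ 2 - C (81 / 256)) ^ 2 - C (27 / 64) * (X ^ 2 - C (81 / 256)) -
        C (729 / 8192) : Polynomial ℝ) = B
  generalize (X ^ 2 - C (81 / 256) : Polynomial ℝ) = D
  -- Only degrees in `y` matter: the coefficients `A`, `B`, `D` are arbitrary polynomials in `x`.
  have hr : (C A * X ^ 2 + C B).natDegree < 4 :=
    lt_of_le_of_lt (b := 2) (by compute_degree) (by norm_num)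
  have hq : (X ^ 4 + (C A * X ^ 2 + C B)).Monic :=
    monic_X_pow_add (Polynomial.degree_le_natDegree.trans_lt (by exact_mod_cast hr))
  have hqd : ((X ^ 4 + (C A * X ^ 2 + C B)) ^ 2).natDegree = 8 := by
    rw [hq.natDegree_pow, Polynomial.natDegree_add_eq_left_of_natDegree_lt
      (by rwa [Polynomial.natDegree_X_pow]), Polynomial.natDegree_X_pow]
  have hs : (2 * (X ^ 2 + C D) ^ 3).natDegree < ((X ^ 4 + (C A * X ^ 2 + C B)) ^ 2).natDegree := by
    rw [hqd]
    exact lt_of_le_of_lt (b := 6) (by compute_degree) (by norm_num)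
  exact ⟨(hq.pow 2).add_of_left (Polynomial.degree_lt_degree hs),
    (Polynomial.natDegree_add_eq_left_of_natDegree_lt hs).trans hqd⟩

theorem totalDegree_exampleOctic : exampleOctic.totalDegree = 8 := by
  refine le_antisymm ?_ ?_
  · have hadd : ∀ {p q : MvPolynomial (Fin 2) ℝ} {n : ℕ}, p.totalDegree ≤ n → q.totalDegree ≤ n →
        (p + q).totalDegree ≤ n := fun hp hq =>
      (MvPolynomial.totalDegree_add _ _).trans (max_le hp hq)
    have hsub : ∀ {p q : MvPolynomial (Fin 2) ℝ} {n : ℕ}, p.totalDegree ≤ n → q.totalDegree ≤ n →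
        (p - q).totalDegree ≤ n := fun hp hq =>
      (MvPolynomial.totalDegree_sub _ _).trans (max_le hp hq)
    have hC : ∀ (t : ℝ) {p : MvPolynomial (Fin 2) ℝ} {n : ℕ}, p.totalDegree ≤ n →
        (MvPolynomial.C t * p).totalDegree ≤ n := fun t p n hp =>
      (MvPolynomial.totalDegree_mul _ _).trans (by rwa [MvPolynomial.totalDegree_C, zero_add])
    have hpow : ∀ {p : MvPolynomial (Fin 2) ℝ} {n : ℕ} (k : ℕ), p.totalDegree ≤ n →
        (p ^ k).totalDegree ≤ k * n := fun k hp =>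
      (MvPolynomial.totalDegree_pow _ _).trans (Nat.mul_le_mul_left k hp)
    have hX : ∀ i : Fin 2, (MvPolynomial.X i : MvPolynomial (Fin 2) ℝ).totalDegree ≤ 1 :=
      fun i => (MvPolynomial.totalDegree_X i).le
    have hconst : ∀ (t : ℝ) (n : ℕ), (MvPolynomial.C t : MvPolynomial (Fin 2) ℝ).totalDegree ≤ n :=
      fun t n => by simp
    have hm : (MvPolynomial.X 0 ^ 2 + MvPolynomial.X 1 ^ 2 - MvPolynomial.C (81 / 256) :
        MvPolynomial (Fin 2) ℝ).totalDegree ≤ 2 :=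
      hsub (hadd (hpow 2 (hX 0)) (hpow 2 (hX 1))) (hconst _ _)
    -- The cubic is bounded by 4 rather than 3, which is all that the bracket to be squared
    -- requires.
    have ht : (MvPolynomial.X 0 ^ 3 - MvPolynomial.C 3 * MvPolynomial.X 0 * MvPolynomial.X 1 ^ 2 :
        MvPolynomial (Fin 2) ℝ).totalDegree ≤ 4 := by
      refine hsub ((hpow 3 (hX 0)).trans (by norm_num)) ((MvPolynomial.totalDegree_mul _ _).trans ?_)
      exact (Nat.add_le_add (hC 3 (hX 0)) (hpow 2 (hX 1))).trans (by norm_num)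
    refine hadd (hpow 2 (n := 4) (hsub (hsub (hadd (hC _ ht) (hpow 2 hm))
      (hC _ (hm.trans (by norm_num)))) (hconst _ _))) (hC _ ((hpow 3 hm).trans (by norm_num)))
  · rw [← monic_exampleOctic.2]
    exact natDegree_equivMvPolynomial_symm_le _

theorem isDefiningPolynomial_exampleOctic :
    IsDefiningPolynomial exampleOctic (supportCurve exampleSupport) := by
  have h := vanishesOn_exampleOctic
  rw [exampleSupport_eq] at *
  exact isDefiningPolynomial_of_monic 1 1 exampleCoeff 0 one_ne_zero one_ne_zero
    (Or.inl (by simp [exampleCoeff])) exampleOctic monic_exampleOctic.1 monic_exampleOctic.2 h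

/-- On a circle the quadratic equation `g` would vanish, so the octic would divide a nonzero
polynomial of degree at most 2. -/
theorem not_isCircle_supportCurve_exampleSupport : ¬ IsCircle (supportCurve exampleSupport) := by
  rintro ⟨c, r, h⟩
  set g : MvPolynomial (Fin 2) ℝ := (MvPolynomial.X 0 - MvPolynomial.C (c 0)) ^ 2 +
    ((MvPolynomial.X 1 - MvPolynomial.C (c 1)) ^ 2 - MvPolynomial.C (r ^ 2)) with hg
  have hdvd : exampleOctic ∣ g := by
    refine (isDefiningPolynomial_exampleOctic.2 g).1 ?_
    rw [h]
    intro P hP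
    rw [mem_sphere_iff_norm, EuclideanSpace.norm_eq] at hP
    have h2 := Real.sq_sqrt (Finset.sum_nonneg fun i (_ : i ∈ Finset.univ) => sq_nonneg ‖(P - c) i‖)
    rw [hP, Fin.sum_univ_two] at h2
    simp only [PiLp.sub_apply, Real.norm_eq_abs, sq_abs] at h2
    simp only [hg, map_add, map_sub, map_pow, MvPolynomial.eval_C, MvPolynomial.eval_X]
    linarith
  have hg0 : g ≠ 0 := by
    intro h0
    -- A point at distance `|r| + 1` from the centre, where `g` is positive for every real `r`.
    have h1 := congrArg (MvPolynomial.eval ![c 0 + |r| + 1, c 1]) h0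
    simp [hg] at h1
    nlinarith [abs_nonneg r, sq_abs r]
  have hgd : g.totalDegree ≤ 2 := by
    have hlin : ∀ (i : Fin 2) (t : ℝ),
        ((MvPolynomial.X i - MvPolynomial.C t) ^ 2 : MvPolynomial (Fin 2) ℝ).totalDegree ≤ 2 := by
      intro i t
      refine (MvPolynomial.totalDegree_pow _ _).trans ?_
      have := MvPolynomial.totalDegree_sub_C_le (MvPolynomial.X i : MvPolynomial (Fin 2) ℝ) t
      rw [MvPolynomial.totalDegree_X] at this
      omega
    exact (MvPolynomial.totalDegree_add _ _).trans (max_le (hlin 0 _)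
      ((MvPolynomial.totalDegree_sub_C_le _ _).trans (hlin 1 _)))
  have := MvPolynomial.totalDegree_le_of_dvd_of_isDomain hdvd hg0
  rw [totalDegree_exampleOctic] at this
  omega

end ConstantWidth

theorem corollary2p1 :
    -- the minimal degree of a defining polynomial is 8
    IsLeast {d : ℕ | ∃ (α : ℝ) (C : Set (EuclideanSpace ℝ (Fin 2)))
        (f : MvPolynomial (Fin 2) ℝ),
        IsAlgebraicCurveOfConstantWidth α C ∧ ¬ IsCircle C ∧
          IsDefiningPolynomial f C ∧ f.totalDegree = d} 8 ∧
    -- no nonzero polynomial at all of degree below 8 vanishes on such a curve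
    (∀ (α : ℝ) (C : Set (EuclideanSpace ℝ (Fin 2))),
        IsAlgebraicCurveOfConstantWidth α C → ¬ IsCircle C →
          ∀ g : MvPolynomial (Fin 2) ℝ, g ≠ 0 → VanishesOn g C → 8 ≤ g.totalDegree) ∧
    -- the degree 8 is attained by `p = 1/2 + (1/16) cos 3θ`
    (IsConstantWidthSupport 1 exampleSupport ∧
      ¬ IsCircle (supportCurve exampleSupport) ∧
      ∃ f : MvPolynomial (Fin 2) ℝ,
        IsDefiningPolynomial f (supportCurve exampleSupport) ∧ f.totalDegree = 8) := by
  have hex : IsAlgebraicCurveOfConstantWidth 1 (supportCurve exampleSupport) :=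
    ⟨exampleSupport, isConstantWidthSupport_exampleSupport, rfl⟩
  refine ⟨⟨⟨1, _, exampleOctic, hex, not_isCircle_supportCurve_exampleSupport,
    isDefiningPolynomial_exampleOctic, totalDegree_exampleOctic⟩, ?_⟩,
    fun α C hC hcirc g hg hvan => eight_le_totalDegree hC hcirc g hg hvan,
    isConstantWidthSupport_exampleSupport, not_isCircle_supportCurve_exampleSupport,
    exampleOctic, isDefiningPolynomial_exampleOctic, totalDegree_exampleOctic⟩
  rintro _ ⟨α, C, f, hC, hcirc, hf, rfl⟩
  exact eight_le_totalDegree hC hcirc f hf.1.ne_zero ((hf.2 f).2 dvd_rfl)
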